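/- Let $\varepsilon\in\{1,-1\}$ and let $(M,g_M)$ be a smooth Lorentzian manifold of odd dimension with a $(1,1)$-tensor field $\phi$, a vector field $\xi$ and a $1$-form $\eta$ such that, for all vector fields $X,Y$, $$\phi^2X=\varepsilon X+\eta(X)\xi,\quad g_M(\phi X,\phi Y)=g_M(X,Y)+\eta(X)\eta(Y),\quad \eta(X)=\varepsilon g_M(X,\xi),\quad \eta(\xi)=-\varepsilon,$$ and assume that $M$ is Lorentzian Sasakian ($\varepsilon=-1$) or Lorentzian para-Sasakian ($\varepsilon=1$), that is, with the Levi-Civita connection $\nabla$ of $g_M$, $$(\nabla_X\phi)Y=\varepsilon\, g_M(\phi X,\phi Y)\,\xi+\eta(Y)\,\phi^2X .$$ Let $(N,g_N)$ be a Lorentzian manifold and let $F:M\to N$ be a semi-Riemannian submersion of $M$ onto $N$: a smooth surjective submersion such that $g_M$ is nondegenerate on $\ker F_*$ and $g_N(F_*X,F_*Y)=g_M(X,Y)$ for $X,Y$ in the horizontal distribution $(\ker F_*)^\perp$. Assume that $F$ is anti-invariant, i.e. $\phi(\ker F_*)\subseteq(\ker F_*)^\perp$, and that $\xi$ is horizontal.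 Let $\mathcal V,\mathcal H$ be the projections of $TM=\ker F_*\oplus(\ker F_*)^\perp$ onto the two summands. For horizontal $X$ write $\phi X=BX+CX$ with $BX=\mathcal V\phi X\in\Gamma(\ker F_*)$ and $CX=\mathcal H\phi X$ (which lies in the orthogonal complement $\mu$ of $\phi(\ker F_*)$ in $(\ker F_*)^\perp$). Let $$\mathcal A_EG=\mathcal V\nabla_{\mathcal HE}\mathcal HG+\mathcal H\nabla_{\mathcal HE}\mathcal VG$$ be O'Neill's tensor, and let $(\nabla F_*)(X,Y)=\nabla^F_X(F_*Y)-F_*(\nabla_XY)$ be the second fundamental form of $F$, where $\nabla^F$ is the pullback along $F$ of the Levi-Civita connection of $g_N$. Then the following are equivalent. (i) $(\ker F_*)^\perp$ defines a totally geodesic foliation on $M$, i.e. it is integrable and its integral manifolds are totally geodesic in $M$. (ii) For all $X,Y\in\Gamma((\ker F_*)^\perp)$ and $V\in\Gamma(\ker F_*)$, $$g_M(\mathcal A_XBY,\phi V)=g_M(CY,\phi\mathcal A_XV)+\varepsilon\,\eta(Y)\,g_M(X,\phi V).$$ (iii) For all $X,Y\in\Gamma((\ker F_*)^\perp)$ and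 $V\in\Gamma(\ker F_*)$, $$g_N\big((\nabla F_*)(Y,\phi X),F_*(\phi V)\big)=g_M(CY,\phi\mathcal A_XV)+\varepsilon\,\eta(Y)\,g_M(X,\phi V).$$ -/

import Mathlib

open scoped Manifold ContDiff Topology Bundle
open Bundle

universe u v

/-! Manifolds of dimension `d` are modelled on `EuclideanSpace ℝ (Fin d)`, with model `𝓡 d`. -/

namespace SemiRiem

/-- The model space of `d`-dimensional manifolds. -/
abbrev Model (d : ℕ) : Type := EuclideanSpace ℝ (Fin d)

/-- A (not necessarily continuous) vector field on a `d`-dimensional manifold. -/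
abbrev VField (d : ℕ) (M : Type u) [TopologicalSpace M] [ChartedSpace (Model d) M] : Type u :=
  ∀ x : M, TangentSpace (𝓡 d) x

section Basic

variable {d : ℕ} {M : Type u} [TopologicalSpace M] [ChartedSpace (Model d) M]
  [IsManifold (𝓡 d) ∞ M]

/-- `X` is a smooth vector field, i.e. `X ∈ Γ(TM)`. -/
def IsSmoothField (X : VField d M) : Prop :=
  ContMDiff (𝓡 d) (𝓡 d).tangent ∞ (fun x => (⟨x, X x⟩ : TangentBundle (𝓡 d) M))

/-- A pointwise linear family of subspaces of the tangent spaces of `M`. -/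
abbrev Distribution (d : ℕ) (M : Type u) [TopologicalSpace M] [ChartedSpace (Model d) M] : Type u :=
  ∀ x : M, Submodule ℝ (TangentSpace (𝓡 d) x)

/-- `X ∈ Γ(D)`: a smooth vector field with values in `D`. -/
def IsSectionOf (D : Distribution d M) (X : VField d M) : Prop :=
  IsSmoothField X ∧ ∀ x, X x ∈ D x

end Basic

/-- A smooth semi-Riemannian metric: a smooth family of symmetric nondegenerate bilinear forms on
the tangent spaces. -/
structure Metric (d : ℕ) (M : Type u) [TopologicalSpace M] [ChartedSpace (Model d) M]
    [IsManifold (𝓡 d) ∞ M] where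
  /-- The scalar product on the tangent spaces. -/
  form (x : M) : TangentSpace (𝓡 d) x →L[ℝ] TangentSpace (𝓡 d) x →L[ℝ] ℝ
  symm (x : M) (v w : TangentSpace (𝓡 d) x) : form x v w = form x w v
  nondegenerate (x : M) (v : TangentSpace (𝓡 d) x) (hv : ∀ w, form x v w = 0) : v = 0
  smooth : ContMDiff (𝓡 d) ((𝓡 d).prod 𝓘(ℝ, Model d →L[ℝ] Model d →L[ℝ] ℝ)) ∞
    (fun x => TotalSpace.mk' (Model d →L[ℝ] Model d →L[ℝ] ℝ) x (form x))

section Connection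

variable {d : ℕ} {M : Type u} [TopologicalSpace M] [ChartedSpace (Model d) M]
  [IsManifold (𝓡 d) ∞ M]

/-- A metric is Lorentzian if it has index one: at every point there is a timelike vector, whose
orthogonal complement is positive definite. -/
def Metric.IsLorentzian (g : Metric d M) : Prop :=
  ∀ x : M, ∃ v : TangentSpace (𝓡 d) x, g.form x v v < 0 ∧
    ∀ w : TangentSpace (𝓡 d) x, g.form x v w = 0 → w ≠ 0 → 0 < g.form x w w

/-- The musical isomorphism `v ↦ g(v, ·)` of `T_x M` with its dual. -/
noncomputable def Metric.flat (g : Metric d M) (x : M) :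
    TangentSpace (𝓡 d) x ≃ₗ[ℝ] Module.Dual ℝ (TangentSpace (𝓡 d) x) :=
  haveI : FiniteDimensional ℝ (TangentSpace (𝓡 d) x) :=
    inferInstanceAs (FiniteDimensional ℝ (Model d))
  LinearMap.linearEquivOfInjective
    (ContinuousLinearMap.coeLM ℝ ∘ₗ (g.form x).toLinearMap)
    (by
      rw [injective_iff_map_eq_zero]
      intro v hv
      exact g.nondegenerate x v fun w => DFunLike.congr_fun hv w)
    Subspace.dual_finrank_eq.symm

/-- The matrix `(g_{ij})` of the metric in the preferred chart at `p`, as a function on `M`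
(meaningful near `p`) with values in the bilinear forms on the model space:
`(u, w) ↦ g_y(S u, S w)`, where `S` is the inverse of the differential of the chart at `y`. -/
noncomputable def Metric.inChart (g : Metric d M) (p : M) (y : M) :
    Model d →L[ℝ] Model d →L[ℝ] ℝ :=
  let S := (trivializationAt (Model d) (TangentSpace (𝓡 d)) p).symmL ℝ y
  ContinuousLinearMap.precomp ℝ S ∘L g.form y ∘L S

/-- The derivative at `p` of the matrix of the metric in the preferred chart at `p`:
`dInChart g p u v w = ∂_u (g(v, w))`. -/
noncomputable def Metric.dInChart (g : Metric d M) (p : M) :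
    Model d →L[ℝ] Model d →L[ℝ] Model d →L[ℝ] ℝ :=
  mvfderiv (𝓡 d) (g.inChart p) p

/-- The Christoffel symbol of the first kind at `p`, in the preferred chart at `p`:
`w ↦ ½ (∂_u g(v, w) + ∂_v g(u, w) - ∂_w g(u, v))`. -/
noncomputable def Metric.christoffelForm (g : Metric d M) (p : M) (u v : Model d) :
    Module.Dual ℝ (Model d) :=
  (((1 / 2 : ℝ) • (g.dInChart p u v + g.dInChart p v u
    - ((g.dInChart p).flip u).flip v) : Model d →L[ℝ] ℝ)).toLinearMap

/-- The Christoffel symbol of the second kind `Γ_p(u, v)`: the vector with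
`g_p(Γ_p(u, v), w) = ½ (∂_u g(v, w) + ∂_v g(u, w) - ∂_w g(u, v))` for all `w`. -/
noncomputable def Metric.christoffel (g : Metric d M) (p : M) (u v : TangentSpace (𝓡 d) p) :
    TangentSpace (𝓡 d) p :=
  (g.flat p).symm (g.christoffelForm p u v)

end Connection

section Along

variable {k d : ℕ} {L : Type v} [TopologicalSpace L] [ChartedSpace (Model k) L]
  {M : Type u} [TopologicalSpace M] [ChartedSpace (Model d) M] [IsManifold (𝓡 d) ∞ M]

/-- The covariant derivative `(∇^f_v W)(q)` of a vector field `W` along `f : L → M` (a section of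
`f⁻¹TM`) with respect to the pullback of the Levi-Civita connection of `g`, in the direction
`v ∈ T_q L`. In the preferred chart at `f q` it is `∂_v Wⁱ + Γⁱ_{jl} (df v)ʲ Wˡ`. -/
noncomputable def covAlong (g : Metric d M) (f : L → M)
    (W : ∀ q : L, TangentSpace (𝓡 d) (f q)) (q : L) (v : TangentSpace (𝓡 k) q) :
    TangentSpace (𝓡 d) (f q) :=
  let dW : TangentSpace (𝓡 d) (f q) :=
    mvfderiv (𝓡 k) (fun y : L => (trivializationAt (Model d) (TangentSpace (𝓡 d)) (f q)
      (⟨f y, W y⟩ : TangentBundle (𝓡 d) M)).2) q v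
  dW + g.christoffel (f q) (mfderiv (𝓡 k) (𝓡 d) f q v) (W q)

/-- The vector field `f_* X` along `f`. -/
noncomputable def push (f : L → M) (X : VField k L) (q : L) : TangentSpace (𝓡 d) (f q) :=
  mfderiv (𝓡 k) (𝓡 d) f q (X q)

end Along

section Main

variable {d : ℕ} {M : Type u} [TopologicalSpace M] [ChartedSpace (Model d) M]
  [IsManifold (𝓡 d) ∞ M]

/-- The Levi-Civita connection `∇_X Y` of `g`. -/
noncomputable def nabla (g : Metric d M) (X Y : VField d M) : VField d M :=
  fun p => covAlong g (fun x : M => x) Y p (X p)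

/-- `f : L → M` exhibits `L` as an integral manifold of `D`: an injectively immersed submanifold
of `M` whose tangent spaces are the spaces of `D`. -/
structure IsIntegralManifold {k : ℕ} {L : Type u} [TopologicalSpace L] [ChartedSpace (Model k) L]
    (D : Distribution d M) (f : L → M) : Prop where
  smooth : ContMDiff (𝓡 k) (𝓡 d) ∞ f
  injective : Function.Injective f
  immersion : ∀ q, Function.Injective (mfderiv (𝓡 k) (𝓡 d) f q)
  tangent : ∀ q, ∀ w : TangentSpace (𝓡 d) (f q),
    w ∈ D (f q) ↔ ∃ v : TangentSpace (𝓡 k) q, mfderiv (𝓡 k) (𝓡 d) f q v = w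

/-- The distribution `D` is integrable, i.e. defines a foliation: through every point there passes
an integral manifold. -/
def IsIntegrable (D : Distribution d M) : Prop :=
  ∀ p : M, ∃ (k : ℕ) (L : Type u) (_ : TopologicalSpace L) (_ : ChartedSpace (Model k) L)
    (f : L → M), IsManifold (𝓡 k) ∞ L ∧ T2Space L ∧ SecondCountableTopology L ∧
      IsIntegralManifold (k := k) D f ∧ p ∈ Set.range f

/-- The immersed submanifold `f : L → M` is totally geodesic: its second fundamental form, the
normal part of `∇^f_X f_* Y` for `X, Y ∈ Γ(TL)`, vanishes. -/
def IsTotallyGeodesicImmersion {k : ℕ} {L : Type u} [TopologicalSpace L]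
    [ChartedSpace (Model k) L] [IsManifold (𝓡 k) ∞ L] (g : Metric d M) (f : L → M) : Prop :=
  ∀ X Y : VField k L, IsSmoothField X → IsSmoothField Y → ∀ q : L,
    ∃ v : TangentSpace (𝓡 k) q,
      mfderiv (𝓡 k) (𝓡 d) f q v = covAlong g f (push f Y) q (X q)

/-- `D` defines a totally geodesic foliation: it is integrable, and its integral manifolds are
totally geodesic submanifolds of `(M, g)`. (Being totally geodesic is a local property, and every
integral manifold is locally an open piece of a leaf; so this is the same as asking it of the
leaves, the maximal connected integral manifolds.) -/
def DefinesTotallyGeodesicFoliation (g : Metric d M) (D : Distribution d M) : Prop :=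
  IsIntegrable D ∧
    ∀ (k : ℕ) (L : Type u) [TopologicalSpace L] [ChartedSpace (Model k) L]
      [IsManifold (𝓡 k) ∞ L] [T2Space L] [SecondCountableTopology L] (f : L → M),
      IsIntegralManifold (k := k) D f → IsTotallyGeodesicImmersion (k := k) g f

/-- A field `φ` of endomorphisms of the tangent spaces, a tensor field of type `(1, 1)`. -/
abbrev EndField (d : ℕ) (M : Type u) [TopologicalSpace M] [ChartedSpace (Model d) M] : Type u :=
  ∀ x : M, TangentSpace (𝓡 d) x →L[ℝ] TangentSpace (𝓡 d) x

/-- A Lorentzian almost contact (`ε = -1`) or almost paracontact (`ε = 1`) structure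
`(φ, ξ, η)` on `(M, g)`. -/
structure IsLorentzianAlmostContact (ε : ℝ) (g : Metric d M) (φ : EndField d M)
    (ξ : VField d M) (η : ∀ x : M, TangentSpace (𝓡 d) x →L[ℝ] ℝ) : Prop where
  eps : ε = 1 ∨ ε = -1
  odd : Odd d
  lorentzian : g.IsLorentzian
  smooth_phi : ContMDiff (𝓡 d) ((𝓡 d).prod 𝓘(ℝ, Model d →L[ℝ] Model d)) ∞
    (fun x => TotalSpace.mk' (Model d →L[ℝ] Model d) x (φ x))
  smooth_xi : IsSmoothField ξ
  smooth_eta : ContMDiff (𝓡 d) ((𝓡 d).prod 𝓘(ℝ, Model d →L[ℝ] ℝ)) ∞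
    (fun x => TotalSpace.mk' (Model d →L[ℝ] ℝ) x (η x))
  phi_sq : ∀ (x : M) (v : TangentSpace (𝓡 d) x), φ x (φ x v) = ε • v + η x v • ξ x
  metric_phi : ∀ (x : M) (v w : TangentSpace (𝓡 d) x),
    g.form x (φ x v) (φ x w) = g.form x v w + η x v * η x w
  eta_eq : ∀ (x : M) (v : TangentSpace (𝓡 d) x), η x v = ε * g.form x v (ξ x)
  eta_xi : ∀ x : M, η x (ξ x) = -ε

/-- The vector field `φ X`. -/
noncomputable def EndField.app (φ : EndField d M) (X : VField d M) : VField d M := fun x => φ x (X x)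

/-- A Lorentzian Sasakian (`ε = -1`) or Lorentzian para-Sasakian (`ε = 1`) structure: a Lorentzian
almost (para)contact structure with `(∇_X φ) Y = ε g(φ X, φ Y) ξ + η(Y) φ² X`, where
`(∇_X φ) Y = ∇_X (φ Y) - φ (∇_X Y)`. -/
structure IsLorentzianSasakian (ε : ℝ) (g : Metric d M) (φ : EndField d M)
    (ξ : VField d M) (η : ∀ x : M, TangentSpace (𝓡 d) x →L[ℝ] ℝ) : Prop
    extends IsLorentzianAlmostContact ε g φ ξ η where
  nabla_phi : ∀ X Y : VField d M, IsSmoothField X → IsSmoothField Y → ∀ x : M,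
    nabla g X (φ.app Y) x - φ x (nabla g X Y x)
      = (ε * g.form x (φ x (X x)) (φ x (Y x))) • ξ x + η x (Y x) • φ x (φ x (X x))

end Main

section Submersion

variable {d n : ℕ} {M : Type u} [TopologicalSpace M] [ChartedSpace (Model d) M]
  [IsManifold (𝓡 d) ∞ M]
  {N : Type v} [TopologicalSpace N] [ChartedSpace (Model n) N]

/-- The vertical distribution `ker F_*`. -/
noncomputable def vert (d n : ℕ) {M : Type u} [TopologicalSpace M] [ChartedSpace (Model d) M]
    {N : Type v} [TopologicalSpace N] [ChartedSpace (Model n) N] (F : M → N) :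
    Distribution d M :=
  fun x => LinearMap.ker (mfderiv (𝓡 d) (𝓡 n) F x).toLinearMap

/-- The orthogonal complement of a distribution. -/
noncomputable def orth (g : Metric d M) (D : Distribution d M) : Distribution d M := fun x =>
  { carrier := {v | ∀ w ∈ D x, g.form x v w = 0}
    add_mem' := by
      intro a b ha hb w hw
      simp [ha w hw, hb w hw]
    zero_mem' := by intro w _; simp
    smul_mem' := by
      intro c a ha w hw
      simp [ha w hw] }

/-- The horizontal distribution `(ker F_*)^⊥`. -/
noncomputable def horiz (n : ℕ) {N : Type v} [TopologicalSpace N] [ChartedSpace (Model n) N]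
    (g : Metric d M) (F : M → N) : Distribution d M :=
  orth g (vert d n F)

variable [IsManifold (𝓡 n) ∞ N]

/-- `F : (M, gM) → (N, gN)` is a semi-Riemannian submersion (of `M` onto `N`). The fibres are
semi-Riemannian submanifolds: the metric restricted to their tangent spaces `ker F_*` is
nondegenerate. -/
structure IsSemiRiemannianSubmersion (gM : Metric d M) (gN : Metric n N) (F : M → N) : Prop where
  smooth : ContMDiff (𝓡 d) (𝓡 n) ∞ F
  onto : Function.Surjective F
  submersion : ∀ x : M, Function.Surjective (mfderiv (𝓡 d) (𝓡 n) F x)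
  fibres : ∀ (x : M), ∀ v ∈ vert d n F x, (∀ w ∈ vert d n F x, gM.form x v w = 0) → v = 0
  isometry : ∀ (x : M), ∀ v ∈ horiz n gM F x, ∀ w ∈ horiz n gM F x,
    gN.form (F x) (mfderiv (𝓡 d) (𝓡 n) F x v) (mfderiv (𝓡 d) (𝓡 n) F x w) = gM.form x v w

variable {gM : Metric d M} {gN : Metric n N} {F : M → N}

theorem IsSemiRiemannianSubmersion.isCompl (hF : IsSemiRiemannianSubmersion gM gN F) (x : M) :
    IsCompl (vert d n F x) (horiz n gM F x) := by
  have : FiniteDimensional ℝ (TangentSpace (𝓡 d) x) :=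
    inferInstanceAs (FiniteDimensional ℝ (Model d))
  let b : LinearMap.BilinForm ℝ (TangentSpace (𝓡 d) x) :=
    ContinuousLinearMap.coeLM ℝ ∘ₗ (gM.form x).toLinearMap
  have hb : b.IsRefl := fun v w h => (gM.symm x w v).trans h
  have hO : b.orthogonal (vert d n F x) = horiz n gM F x := by
    ext v
    rw [LinearMap.BilinForm.mem_orthogonal_iff]
    exact forall₂_congr fun w _ => by
      change gM.form x w v = 0 ↔ gM.form x v w = 0
      rw [gM.symm]
  rw [← hO, LinearMap.BilinForm.isCompl_orthogonal_iff_disjoint hb, hO, Submodule.disjoint_def]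
  exact fun v hv hv' => hF.fibres x v hv hv'

/-- The vertical part `𝒱 E` of a vector field. -/
noncomputable def verPart (hF : IsSemiRiemannianSubmersion gM gN F) (E : VField d M) :
    VField d M :=
  fun x => (vert d n F x).projection (horiz n gM F x) (hF.isCompl x) (E x)

/-- The horizontal part `ℋ E` of a vector field. -/
noncomputable def horPart (hF : IsSemiRiemannianSubmersion gM gN F) (E : VField d M) :
    VField d M :=
  fun x => (horiz n gM F x).projection (vert d n F x) (hF.isCompl x).symm (E x)

/-- O'Neill's tensor `𝒜_E G = 𝒱 ∇_{ℋ E} ℋ G + ℋ ∇_{ℋ E} 𝒱 G`. -/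
noncomputable def oneillA (hF : IsSemiRiemannianSubmersion gM gN F) (E G : VField d M) :
    VField d M := fun x =>
  verPart hF (nabla gM (horPart hF E) (horPart hF G)) x
    + horPart hF (nabla gM (horPart hF E) (verPart hF G)) x

/-- The second fundamental form `(∇F_*)(X, Y) = ∇^F_X (F_* Y) - F_*(∇_X Y)` of `F`, a vector field
along `F`. -/
noncomputable def secondFF (gM : Metric d M) (gN : Metric n N) (F : M → N) (X Y : VField d M)
    (x : M) : TangentSpace (𝓡 n) (F x) :=
  covAlong gN F (push F Y) x (X x) - mfderiv (𝓡 d) (𝓡 n) F x (nabla gM X Y x)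

/-- `F` is anti-invariant: `φ(ker F_*) ⊆ (ker F_*)^⊥`. -/
def IsAntiInvariant (gM : Metric d M) (φ : EndField d M) (n : ℕ) {N : Type v}
    [TopologicalSpace N] [ChartedSpace (Model n) N] (F : M → N) : Prop :=
  ∀ (x : M), ∀ v ∈ vert d n F x, φ x v ∈ horiz n gM F x

/-- `B X`, the vertical part of `φ X`. -/
noncomputable def partB (hF : IsSemiRiemannianSubmersion gM gN F) (φ : EndField d M)
    (X : VField d M) : VField d M :=
  verPart hF (φ.app X)

/-- `C X`, the horizontal part of `φ X`. For `X` horizontal, `φ` anti-invariant and `ξ` horizontal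
it lies in the orthogonal complement `μ` of `φ(ker F_*)` in `(ker F_*)^⊥`, because
`g(φ X, φ V) = g(X, V) + η(X) η(V) = 0` for `V` vertical. -/
noncomputable def partC (hF : IsSemiRiemannianSubmersion gM gN F) (φ : EndField d M)
    (X : VField d M) : VField d M :=
  horPart hF (φ.app X)

end Submersion

end SemiRiem

/-! Each of the three conditions is equivalent to `ker F_* = 0`. If the vertical space vanishes,
every vertical `V` is zero and (ii), (iii) read `0 = 0`, while the horizontal distribution is all of
`TM`, so (i) is trivial. For the converses it is enough to prove `g(V, W) = 0` for all vertical `V`,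
`W`, since the fibre metric is nondegenerate. Anti-invariance makes `φV` horizontal, `ξ` is
horizontal, and `g(φV, φW) = g(V, W)` because `η` vanishes on vertical vectors.

From (i): `∇_Z ξ` equals `ε φZ` modulo `ξ`, so total geodesy makes `φ` preserve the horizontal
space. Hence `φ²W` is horizontal and `g(V, W) = g(φV, φW) = ε g(V, φ²W) = 0`.

From (ii): take `X = φV`, `Y = ξ`. As `φξ = 0`, both `Bξ` and `Cξ` vanish and what remains is `0 =
-g(φV, φW)`.

From (iii), with the same choice: the equation becomes `ε g(∇_ξ V, φW) = g(V, W)`. Skewness of `(X,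
Y) ↦ g(∇_X V, Y)` on horizontal fields (`nabla_vert_skew`) gives `g(∇_ξ V, φW) = g(V, W)`, so (iii)
says `ε g(V, W) = g(V, W)`. Differentiating `g(V, φW) = 0` along `ξ` yields in addition `g(V, W) =
-ε g(V, W)`. The two together force `g(V, W) = 0` for either sign. -/

namespace SemiRiem

/-! ### Derivatives of vector-valued functions in a chart. -/

section Calculus

variable {k : ℕ} {L : Type v} [TopologicalSpace L] [ChartedSpace (Model k) L]
  {E E' : Type*} [NormedAddCommGroup E] [NormedSpace ℝ E] [NormedAddCommGroup E']
  [NormedSpace ℝ E']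

/-- The derivative at `q` of a vector-valued function, in the preferred chart at `q`. -/
noncomputable def chartDeriv (h : L → E) (q : L) : Model k →L[ℝ] E :=
  fderiv ℝ (h ∘ (extChartAt (𝓡 k) q).symm) (extChartAt (𝓡 k) q q)

theorem hasFDerivAt_chartDeriv {h : L → E} {q : L}
    (hh : MDifferentiableAt (𝓡 k) 𝓘(ℝ, E) h q) :
    HasFDerivAt (h ∘ (extChartAt (𝓡 k) q).symm) (chartDeriv h q) (extChartAt (𝓡 k) q q) := by
  have h1 : DifferentiableWithinAt ℝ (h ∘ (extChartAt (𝓡 k) q).symm) (Set.range (𝓡 k))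
      (extChartAt (𝓡 k) q q) :=
    hh.hasMFDerivAt.2.differentiableWithinAt
  rw [(𝓡 k).range_eq_univ] at h1
  exact (differentiableWithinAt_univ.1 h1).hasFDerivAt

theorem mvfderiv_apply {h : L → E} {q : L} (hh : MDifferentiableAt (𝓡 k) 𝓘(ℝ, E) h q)
    (v : TangentSpace (𝓡 k) q) : mvfderiv (𝓡 k) h q v = chartDeriv h q v := by
  have h1 : HasFDerivAt (h ∘ (extChartAt (𝓡 k) q).symm)
      (show Model k →L[ℝ] E from mfderiv (𝓡 k) 𝓘(ℝ, E) h q) (extChartAt (𝓡 k) q q) := by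
    have h2 := hh.hasMFDerivAt.2
    simp only [modelWithCornersSelf_coe, Set.range_id] at h2
    exact hasFDerivWithinAt_univ.1 h2
  exact congrArg (fun T : Model k →L[ℝ] E => T v) (h1.unique (hasFDerivAt_chartDeriv hh))

theorem chartDeriv_clm_apply {c : L → E →L[ℝ] E'} {w : L → E} {q : L}
    (hc : MDifferentiableAt (𝓡 k) 𝓘(ℝ, E →L[ℝ] E') c q)
    (hw : MDifferentiableAt (𝓡 k) 𝓘(ℝ, E) w q) (v : Model k) :
    chartDeriv (fun y => c y (w y)) q v =
      chartDeriv c q v (w q) + c q (chartDeriv w q v) := by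
  have h := (hasFDerivAt_chartDeriv (hc.clm_apply hw)).unique
    ((hasFDerivAt_chartDeriv hc).clm_apply (hasFDerivAt_chartDeriv hw))
  rw [h]
  simp [add_comm]

theorem chartDeriv_const (c : E) (q : L) : chartDeriv (k := k) (fun _ : L => c) q = 0 :=
  (hasFDerivAt_const c _).fderiv

theorem mvfderiv_clm_apply {c : L → E →L[ℝ] E'} {w : L → E} {q : L}
    (hc : MDifferentiableAt (𝓡 k) 𝓘(ℝ, E →L[ℝ] E') c q)
    (hw : MDifferentiableAt (𝓡 k) 𝓘(ℝ, E) w q) (v : TangentSpace (𝓡 k) q) :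
    mvfderiv (𝓡 k) (fun y => c y (w y)) q v =
      mvfderiv (𝓡 k) c q v (w q) + c q (mvfderiv (𝓡 k) w q v) := by
  rw [mvfderiv_apply hc, mvfderiv_apply hw, mvfderiv_apply (hc.clm_apply hw)]
  exact chartDeriv_clm_apply hc hw v

theorem _root_.Filter.EventuallyEq.mvfderiv_eq {h₁ h₂ : L → E} {q : L} (h : h₁ =ᶠ[𝓝 q] h₂)
    (v : TangentSpace (𝓡 k) q) : mvfderiv (𝓡 k) h₁ q v = mvfderiv (𝓡 k) h₂ q v :=
  congrArg (fun T => T v) (h.mfderiv_eq (I := 𝓡 k) (I' := 𝓘(ℝ, E)))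

end Calculus

/-! ### Components of tangent vectors in the preferred charts. -/

section Coordinates

variable {d : ℕ} {M : Type u} [TopologicalSpace M] [ChartedSpace (Model d) M]
  [IsManifold (𝓡 d) ∞ M]

/-- The components of a tangent vector at `y` in the preferred chart at `p`. -/
noncomputable def comps (p y : M) (v : TangentSpace (𝓡 d) y) : Model d :=
  (trivializationAt (Model d) (TangentSpace (𝓡 d)) p (⟨y, v⟩ : TangentBundle (𝓡 d) M)).2

/-- The tangent vector at `y` with given components in the preferred chart at `p`. -/
noncomputable def ofComps (p y : M) : Model d →L[ℝ] TangentSpace (𝓡 d) y :=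
  (trivializationAt (Model d) (TangentSpace (𝓡 d)) p).symmL ℝ y

theorem comps_eq_continuousLinearMapAt {p y : M} (hy : y ∈ (chartAt (Model d) p).source)
    (v : TangentSpace (𝓡 d) y) :
    comps p y v =
      (trivializationAt (Model d) (TangentSpace (𝓡 d)) p).continuousLinearMapAt ℝ y v :=
  (congrFun (Trivialization.coe_linearMapAt_of_mem (R := ℝ) _ hy) v).symm

theorem comps_ofComps {p y : M} (hy : y ∈ (chartAt (Model d) p).source) (u : Model d) :
    comps p y (ofComps p y u) = u := by
  rw [comps_eq_continuousLinearMapAt hy]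
  exact Trivialization.continuousLinearMapAt_symmL _ hy u

theorem ofComps_comps {p y : M} (hy : y ∈ (chartAt (Model d) p).source)
    (v : TangentSpace (𝓡 d) y) : ofComps p y (comps p y v) = v := by
  rw [comps_eq_continuousLinearMapAt hy]
  exact Trivialization.symmL_continuousLinearMapAt _ hy v

theorem comps_eq_mfderiv {p y : M} (hy : y ∈ (chartAt (Model d) p).source)
    (v : TangentSpace (𝓡 d) y) :
    comps p y v = mfderiv (𝓡 d) 𝓘(ℝ, Model d) (extChartAt (𝓡 d) p) y v := by
  rw [comps_eq_continuousLinearMapAt hy]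
  exact congrArg (fun T => T v) (TangentBundle.continuousLinearMapAt_trivializationAt hy)

theorem comps_self (p : M) (v : TangentSpace (𝓡 d) p) : comps p p v = v := by
  rw [comps_eq_mfderiv (mem_chart_source _ p), mfderiv_extChartAt_self]
  rfl

theorem ofComps_self (p : M) (v : Model d) : ofComps p p v = v := by
  exact (congrArg (ofComps p p) (comps_self p v)).symm.trans
    (ofComps_comps (mem_chart_source _ p) v)

theorem comps_zero {p y : M} (hy : y ∈ (chartAt (Model d) p).source) :
    comps p y (0 : TangentSpace (𝓡 d) y) = 0 := by
  rw [comps_eq_continuousLinearMapAt hy, map_zero]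

theorem Metric.inChart_apply (g : Metric d M) (p y : M) (u w : Model d) :
    g.inChart p y u w = g.form y (ofComps p y u) (ofComps p y w) := rfl

theorem Metric.contMDiffAt_inChart (g : Metric d M) (p : M) :
    ContMDiffAt (𝓡 d) 𝓘(ℝ, Model d →L[ℝ] Model d →L[ℝ] ℝ) ∞ (g.inChart p) p := by
  have h := ((contMDiffAt_hom_bundle _).1 (g.smooth p)).2
  refine h.congr_of_eventuallyEq ?_
  filter_upwards [(chartAt (Model d) p).open_source.mem_nhds (mem_chart_source _ p)] with y hy
  ext u w
  rw [Metric.inChart_apply]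
  refine Eq.trans ?_ (inCoordinates_apply_eq₂ (E₁ := TangentSpace (𝓡 d))
    (E₂ := TangentSpace (𝓡 d)) (E₃ := fun _ : M => ℝ) hy hy (by simp)).symm
  rw [ofComps, Trivialization.symmL_apply _ hy, Trivialization.symmL_apply _ hy]
  simp

end Coordinates

/-! ### Christoffel symbols and metric compatibility of the pullback connection. -/

section Along

variable {k d : ℕ} {L : Type v} [TopologicalSpace L] [ChartedSpace (Model k) L]
  {M : Type u} [TopologicalSpace M] [ChartedSpace (Model d) M] [IsManifold (𝓡 d) ∞ M]

/-- `W` is a smooth vector field along `f`. -/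
def IsSmoothAlong (k : ℕ) {L : Type v} [TopologicalSpace L] [ChartedSpace (Model k) L] (f : L → M)
    (W : ∀ q : L, TangentSpace (𝓡 d) (f q)) : Prop :=
  ContMDiff (𝓡 k) (𝓡 d).tangent ∞ (fun y => (⟨f y, W y⟩ : TangentBundle (𝓡 d) M))

theorem IsSmoothAlong.smooth_base {f : L → M} {W : ∀ q : L, TangentSpace (𝓡 d) (f q)}
    (hW : IsSmoothAlong k f W) : ContMDiff (𝓡 k) (𝓡 d) ∞ f :=
  fun q => ((contMDiffAt_totalSpace).1 (hW q)).1

theorem IsSmoothAlong.comps {f : L → M} {W : ∀ q : L, TangentSpace (𝓡 d) (f q)}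
    (hW : IsSmoothAlong k f W) (q : L) :
    ContMDiffAt (𝓡 k) 𝓘(ℝ, Model d) ∞ (fun y => comps (f q) (f y) (W y)) q :=
  ((contMDiffAt_totalSpace).1 (hW q)).2

/-- The derivative of the components of a vector field along `f`, in the preferred chart at
`f q`. -/
noncomputable def compsDeriv (f : L → M) (W : ∀ q : L, TangentSpace (𝓡 d) (f q)) (q : L)
    (v : TangentSpace (𝓡 k) q) : TangentSpace (𝓡 d) (f q) :=
  mvfderiv (𝓡 k) (fun y => SemiRiem.comps (f q) (f y) (W y)) q v

theorem covAlong_eq (g : Metric d M) (f : L → M) (W : ∀ q : L, TangentSpace (𝓡 d) (f q)) (q : L)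
    (v : TangentSpace (𝓡 k) q) :
    covAlong g f W q v = compsDeriv f W q v +
      g.christoffel (f q) (mfderiv (𝓡 k) (𝓡 d) f q v) (W q) := rfl

theorem Metric.christoffel_spec (g : Metric d M) (p : M) (u v w : TangentSpace (𝓡 d) p) :
    g.form p (g.christoffel p u v) w = (1 / 2 : ℝ) *
      (g.dInChart p u v w + g.dInChart p v u w - g.dInChart p w u v) :=
  congrFun (congrArg DFunLike.coe ((g.flat p).apply_symm_apply (g.christoffelForm p u v))) w

theorem Metric.dInChart_symm (g : Metric d M) (p : M) (u v w : Model d) :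
    g.dInChart p u v w = g.dInChart p u w v := by
  have hd : MDifferentiableAt (𝓡 d) 𝓘(ℝ, Model d →L[ℝ] Model d →L[ℝ] ℝ) (g.inChart p) p :=
    (g.contMDiffAt_inChart p).mdifferentiableAt (by simp)
  have key : ∀ v w : Model d,
      mvfderiv (𝓡 d) (fun y => g.inChart p y v w) p u = g.dInChart p u v w := by
    intro v w
    have hv : MDifferentiableAt (𝓡 d) 𝓘(ℝ, Model d) (fun _ : M => v) p := mdifferentiableAt_const
    have hw : MDifferentiableAt (𝓡 d) 𝓘(ℝ, Model d) (fun _ : M => w) p := mdifferentiableAt_const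
    rw [mvfderiv_apply ((hd.clm_apply hv).clm_apply hw) u]
    refine (chartDeriv_clm_apply (hd.clm_apply hv) hw u).trans ?_
    rw [chartDeriv_clm_apply hd hv u, chartDeriv_const, chartDeriv_const]
    refine Eq.trans ?_ (congrArg (fun T => T v w) (mvfderiv_apply hd u).symm)
    simp
  rw [← key v w, ← key w v]
  simp only [Metric.inChart_apply]
  exact congrArg (fun h => mvfderiv (𝓡 d) h p u) (funext fun y => g.symm y _ _)

theorem Metric.christoffel_symm (g : Metric d M) (p : M) (u v : TangentSpace (𝓡 d) p) :
    g.christoffel p u v = g.christoffel p v u := by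
  refine sub_eq_zero.1 (g.nondegenerate p _ fun w => ?_)
  rw [map_sub, sub_apply, g.christoffel_spec, g.christoffel_spec,
    g.dInChart_symm p w u v]
  ring

/-- The infinitesimal form of `∇g = 0`: in the sum of the two Christoffel expressions the terms
differentiating along `v` and `w` cancel. -/
theorem Metric.christoffel_compat (g : Metric d M) (p : M) (u v w : TangentSpace (𝓡 d) p) :
    g.form p (g.christoffel p u v) w + g.form p v (g.christoffel p u w) =
      g.dInChart p u v w := by
  rw [g.symm p v, g.christoffel_spec, g.christoffel_spec, g.dInChart_symm p u w v,
    g.dInChart_symm p w u v, g.dInChart_symm p v u w]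
  ring

/-- Metric compatibility along a map: the product rule in the chart at `f q` produces a derivative
of the metric matrix, which `christoffel_compat` splits into the two Christoffel corrections. -/
theorem mvfderiv_form (g : Metric d M) (f : L → M) {W₁ W₂ : ∀ q : L, TangentSpace (𝓡 d) (f q)}
    (h₁ : IsSmoothAlong k f W₁) (h₂ : IsSmoothAlong k f W₂) (q : L) (v : TangentSpace (𝓡 k) q) :
    mvfderiv (𝓡 k) (fun y => g.form (f y) (W₁ y) (W₂ y)) q v =
      g.form (f q) (covAlong g f W₁ q v) (W₂ q) + g.form (f q) (W₁ q) (covAlong g f W₂ q v) := by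
  have hf : MDifferentiableAt (𝓡 k) (𝓡 d) f q := h₁.smooth_base.mdifferentiable (by simp) q
  have hG : MDifferentiableAt (𝓡 d) 𝓘(ℝ, Model d →L[ℝ] Model d →L[ℝ] ℝ) (g.inChart (f q)) (f q) :=
    (g.contMDiffAt_inChart (f q)).mdifferentiableAt (by simp)
  have hw₁ := (h₁.comps q).mdifferentiableAt (by simp)
  have hw₂ := (h₂.comps q).mdifferentiableAt (by simp)
  have hc := hG.comp q hf
  have hev : (fun y => g.form (f y) (W₁ y) (W₂ y)) =ᶠ[𝓝 q] fun y =>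
      (g.inChart (f q) ∘ f) y (comps (f q) (f y) (W₁ y)) (comps (f q) (f y) (W₂ y)) := by
    filter_upwards [hf.continuousAt.preimage_mem_nhds
      ((chartAt (Model d) (f q)).open_source.mem_nhds (mem_chart_source _ (f q)))] with y hy
    rw [Function.comp_apply, Metric.inChart_apply, ofComps_comps hy, ofComps_comps hy]
  rw [hev.mvfderiv_eq, mvfderiv_clm_apply (hc.clm_apply hw₁) hw₂, mvfderiv_clm_apply hc hw₁]
  have hd : mvfderiv (𝓡 k) (g.inChart (f q) ∘ f) q v =
      g.dInChart (f q) (mfderiv (𝓡 k) (𝓡 d) f q v) :=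
    mfderiv_comp_apply q hG hf v
  have hI : ∀ u w : TangentSpace (𝓡 d) (f q), g.inChart (f q) (f q) u w = g.form (f q) u w :=
    fun u w => congrArg₂ (fun a b => g.form (f q) a b) (ofComps_self _ u) (ofComps_self _ w)
  have e₁ : g.inChart (f q) (f q) (mvfderiv (𝓡 k) (fun y => comps (f q) (f y) (W₁ y)) q v)
      (W₂ q) = g.form (f q) (compsDeriv f W₁ q v) (W₂ q) := hI _ _
  have e₂ : g.inChart (f q) (f q) (W₁ q)
      (mvfderiv (𝓡 k) (fun y => comps (f q) (f y) (W₂ y)) q v) =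
      g.form (f q) (W₁ q) (compsDeriv f W₂ q v) := hI _ _
  rw [hd, covAlong_eq, covAlong_eq, map_add, map_add, add_apply, add_apply, comps_self, comps_self,
    Function.comp_apply, e₁, e₂,
    ← g.christoffel_compat]
  ring

end Along

/-! ### Coordinate formula and symmetry of the second fundamental form of a map. -/

section LocalRep

variable {d n : ℕ} {M : Type u} [TopologicalSpace M] [ChartedSpace (Model d) M]
  {N : Type v} [TopologicalSpace N] [ChartedSpace (Model n) N]

/-- The map `F` in the preferred charts at `p` and `F p`. -/
noncomputable def localRep (d n : ℕ) {M : Type u} [TopologicalSpace M] [ChartedSpace (Model d) M]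
    {N : Type v} [TopologicalSpace N] [ChartedSpace (Model n) N] (F : M → N) (p : M) :
    Model d → Model n :=
  extChartAt (𝓡 n) (F p) ∘ F ∘ (extChartAt (𝓡 d) p).symm

/-- The points near `p` which `F` maps into the domain of the preferred chart at `F p`. -/
def chartDomain (d n : ℕ) {M : Type u} [TopologicalSpace M] [ChartedSpace (Model d) M]
    {N : Type v} [TopologicalSpace N] [ChartedSpace (Model n) N] (F : M → N) (p : M) : Set M :=
  (chartAt (Model d) p).source ∩ F ⁻¹' (chartAt (Model n) (F p)).source

theorem isOpen_chartDomain {F : M → N} (hF : Continuous F) (p : M) :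
    IsOpen (chartDomain d n F p) :=
  (chartAt (Model d) p).open_source.inter ((chartAt (Model n) (F p)).open_source.preimage hF)

theorem mem_chartDomain (F : M → N) (p : M) : p ∈ chartDomain d n F p :=
  ⟨mem_chart_source _ p, mem_chart_source _ (F p)⟩

variable [IsManifold (𝓡 d) ∞ M] [IsManifold (𝓡 n) ∞ N]

theorem contDiffAt_localRep {F : M → N} (hF : ContMDiff (𝓡 d) (𝓡 n) ∞ F) {p y : M}
    (hy : y ∈ chartDomain d n F p) :
    ContDiffAt ℝ ∞ (localRep d n F p) (extChartAt (𝓡 d) p y) := by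
  have hs : y ∈ (extChartAt (𝓡 d) p).source := by simpa using hy.1
  refine ((contMDiff_iff.1 hF).2 p (F p)).contDiffAt (IsOpen.mem_nhds ?_ ⟨?_, ?_⟩)
  · exact (continuousOn_extChartAt_symm p).isOpen_inter_preimage (isOpen_extChartAt_target p)
      ((isOpen_extChartAt_source (F p)).preimage hF.continuous)
  · exact (extChartAt (𝓡 d) p).map_source hs
  · rw [Set.mem_preimage, Set.mem_preimage, (extChartAt (𝓡 d) p).left_inv hs]
    simpa using hy.2

/-- The differential of `F` at `y` in the preferred charts at `p` and `F p`. -/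
noncomputable def localDeriv (d n : ℕ) {M : Type u} [TopologicalSpace M]
    [ChartedSpace (Model d) M] {N : Type v} [TopologicalSpace N] [ChartedSpace (Model n) N]
    (F : M → N) (p y : M) : Model d →L[ℝ] Model n :=
  fderiv ℝ (localRep d n F p) (extChartAt (𝓡 d) p y)

theorem contMDiffAt_localDeriv {F : M → N} (hF : ContMDiff (𝓡 d) (𝓡 n) ∞ F) {p y : M}
    (hy : y ∈ chartDomain d n F p) :
    ContMDiffAt (𝓡 d) 𝓘(ℝ, Model d →L[ℝ] Model n) ∞ (localDeriv d n F p) y :=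
  ((contDiffAt_localRep hF hy).fderiv_right (m := ∞) (by simp)).comp_contMDiffAt
    (contMDiffAt_extChartAt' hy.1)

theorem comps_mfderiv {F : M → N} (hF : ContMDiff (𝓡 d) (𝓡 n) ∞ F) {p y : M}
    (hy : y ∈ chartDomain d n F p) (u : TangentSpace (𝓡 d) y) :
    comps (d := n) (F p) (F y) (mfderiv (𝓡 d) (𝓡 n) F y u) = localDeriv d n F p y (comps p y u) := by
  rw [comps_eq_mfderiv hy.1, comps_eq_mfderiv hy.2]
  have h1 := (mdifferentiableAt_extChartAt (I := 𝓡 n) hy.2).hasMFDerivAt.comp y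
    (hF.mdifferentiable (by simp) y).hasMFDerivAt
  have h2 := ((contDiffAt_localRep hF hy).differentiableAt
    (by simp)).hasFDerivAt.hasMFDerivAt.comp y
    (mdifferentiableAt_extChartAt (I := 𝓡 d) hy.1).hasMFDerivAt
  have he : extChartAt (𝓡 n) (F p) ∘ F =ᶠ[𝓝 y] localRep d n F p ∘ extChartAt (𝓡 d) p := by
    filter_upwards [(chartAt (Model d) p).open_source.mem_nhds hy.1] with z hz
    have hs : z ∈ (extChartAt (𝓡 d) p).source := by simpa using hz
    simp only [localRep, Function.comp_apply, (extChartAt (𝓡 d) p).left_inv hs]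
  exact congrArg (fun T => T u) (hasMFDerivAt_unique h1 (h2.congr_of_eventuallyEq he))

theorem localDeriv_self {F : M → N} (hF : ContMDiff (𝓡 d) (𝓡 n) ∞ F) (p : M)
    (u : TangentSpace (𝓡 d) p) : localDeriv d n F p p u = mfderiv (𝓡 d) (𝓡 n) F p u := by
  have h := comps_mfderiv hF (mem_chartDomain F p) u
  rw [comps_self, comps_self] at h
  exact h.symm

theorem isSmoothAlong_push {F : M → N} (hF : ContMDiff (𝓡 d) (𝓡 n) ∞ F) {Y : VField d M}
    (hY : IsSmoothField Y) : IsSmoothAlong (d := n) d F (push F Y) :=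
  (hF.contMDiff_tangentMap (m := ∞) (by simp)).comp hY

theorem isSmoothAlong_id {Y : VField d M} (hY : IsSmoothField Y) :
    IsSmoothAlong d (fun x : M => x) Y := hY

/-- The second derivative of `F` at `p` in the preferred charts. -/
noncomputable def hessian (F : M → N) (p : M) (u w : TangentSpace (𝓡 d) p) :
    TangentSpace (𝓡 n) (F p) :=
  fderiv ℝ (fderiv ℝ (localRep d n F p)) (extChartAt (𝓡 d) p p) u w

theorem hessian_symm {F : M → N} (hF : ContMDiff (𝓡 d) (𝓡 n) ∞ F) (p : M)
    (u w : TangentSpace (𝓡 d) p) : hessian (n := n) F p u w = hessian F p w u :=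
  (contDiffAt_localRep hF (mem_chartDomain F p)).isSymmSndFDerivAt
    (by rw [minSmoothness_of_isRCLikeNormedField]; exact WithTop.coe_le_coe.2 (le_top : (2 : ℕ∞) ≤ ⊤)) u w

/-- Near `p` the components of `F_* Y` are the Jacobian applied to the components of `Y`; the
product rule gives a Hessian term and a term differentiating `Y`. -/
theorem compsDeriv_push {F : M → N} (hF : ContMDiff (𝓡 d) (𝓡 n) ∞ F) {Y : VField d M}
    (hY : IsSmoothField Y) (p : M) (u : TangentSpace (𝓡 d) p) :
    compsDeriv (d := n) F (push F Y) p u =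
      hessian F p u (Y p) + mfderiv (𝓡 d) (𝓡 n) F p (compsDeriv (fun x : M => x) Y p u) := by
  have hev : (fun y => comps (d := n) (F p) (F y) (push F Y y)) =ᶠ[𝓝 p]
      fun y => localDeriv d n F p y (comps p y (Y y)) := by
    filter_upwards [(isOpen_chartDomain (d := d) (n := n) hF.continuous p).mem_nhds
      (mem_chartDomain F p)] with y hy
    exact comps_mfderiv hF hy (Y y)
  have hD := (contMDiffAt_localDeriv hF (mem_chartDomain F p)).mdifferentiableAt (by simp)
  have hw := ((isSmoothAlong_id hY).comps p).mdifferentiableAt (by simp)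
  have h0 : compsDeriv (d := n) F (push F Y) p u =
      mvfderiv (𝓡 d) (fun y => localDeriv d n F p y (comps p y (Y y))) p u := hev.mvfderiv_eq u
  rw [h0, mvfderiv_clm_apply hD hw, mvfderiv_apply hD]
  have h1 : chartDeriv (localDeriv d n F p) p =
      fderiv ℝ (fderiv ℝ (localRep d n F p)) (extChartAt (𝓡 d) p p) := by
    refine Filter.EventuallyEq.fderiv_eq ?_
    filter_upwards [extChartAt_target_mem_nhds (I := 𝓡 d) p] with z hz
    rw [Function.comp_apply, localDeriv, (extChartAt (𝓡 d) p).right_inv hz]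
  rw [h1, comps_self]
  exact congrArg (fun a => hessian F p u (Y p) + a) (localDeriv_self hF p _)

theorem nabla_eq (g : Metric d M) (X Y : VField d M) (p : M) :
    nabla g X Y p = compsDeriv (fun x : M => x) Y p (X p) + g.christoffel p (X p) (Y p) := by
  have h : mfderiv (𝓡 d) (𝓡 d) (fun x : M => x) p (X p) = X p :=
    congrArg (fun T => T (X p)) (mfderiv_id (I := 𝓡 d) (x := p))
  rw [nabla, covAlong_eq, h]

/-- The derivatives of the components of `Y` cancel between `∇^F_X (F_* Y)` and `F_*(∇_X Y)`. What
is left is bilinear in the values at `p`, and visibly symmetric once the Hessian and the Christoffel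
symbols are. -/
theorem secondFF_eq (gM : Metric d M) (gN : Metric n N) {F : M → N}
    (hF : ContMDiff (𝓡 d) (𝓡 n) ∞ F) (X : VField d M) {Y : VField d M} (hY : IsSmoothField Y)
    (p : M) :
    secondFF gM gN F X Y p = hessian F p (X p) (Y p)
      + gN.christoffel (F p) (mfderiv (𝓡 d) (𝓡 n) F p (X p)) (mfderiv (𝓡 d) (𝓡 n) F p (Y p))
      - mfderiv (𝓡 d) (𝓡 n) F p (gM.christoffel p (X p) (Y p)) := by
  rw [secondFF, covAlong_eq, compsDeriv_push hF hY, nabla_eq, map_add]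
  simp only [push]
  abel

theorem secondFF_symm (gM : Metric d M) (gN : Metric n N) {F : M → N}
    (hF : ContMDiff (𝓡 d) (𝓡 n) ∞ F) {X Y : VField d M} (hX : IsSmoothField X)
    (hY : IsSmoothField Y) (p : M) : secondFF gM gN F X Y p = secondFF gM gN F Y X p := by
  rw [secondFF_eq gM gN hF X hY, secondFF_eq gM gN hF Y hX, hessian_symm hF,
    gN.christoffel_symm, gM.christoffel_symm]

set_option synthInstance.maxHeartbeats 200000 in
theorem covAlong_zero {k : ℕ} {L : Type*} [TopologicalSpace L] [ChartedSpace (Model k) L]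
    (g : Metric d M) {f : L → M} (hf : Continuous f) (q : L) (v : TangentSpace (𝓡 k) q) :
    covAlong (d := d) g f (fun _ => 0) q v = 0 := by
  have hev : (fun y => comps (f q) (f y) (0 : TangentSpace (𝓡 d) (f y))) =ᶠ[𝓝 q]
      fun _ => (0 : Model d) := by
    filter_upwards [hf.continuousAt.preimage_mem_nhds
      ((chartAt (Model d) (f q)).open_source.mem_nhds (mem_chart_source _ (f q)))] with y hy
    exact comps_zero hy
  have h1 : compsDeriv (d := d) f (fun _ => 0) q v = 0 := by
    refine (hev.mvfderiv_eq v).trans ?_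
    exact congrArg (fun T => T v) (mvfderiv_const (I := 𝓡 k) (0 : Model d) (x := q))
  have h2 : ∀ u, g.christoffel (f q) u 0 = 0 := fun u => by
    have h : g.christoffelForm (f q) u (0 : Model d) = 0 := by
      ext w
      simp [Metric.christoffelForm]
      rfl
    exact (congrArg (g.flat (f q)).symm h).trans (map_zero _)
  rw [covAlong_eq, h1, h2, add_zero]

end LocalRep


/-! ### Extending vectors to global smooth sections and lifting fields along immersions. -/

section Extension

variable {d : ℕ} {M : Type u} [TopologicalSpace M] [ChartedSpace (Model d) M]
  [IsManifold (𝓡 d) ∞ M]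

theorem contMDiffAt_ofComps {p y : M} (hy : y ∈ (chartAt (Model d) p).source) {w : M → Model d}
    (hw : ContMDiffAt (𝓡 d) 𝓘(ℝ, Model d) ∞ w y) :
    ContMDiffAt (𝓡 d) (𝓡 d).tangent ∞
      (fun x => (⟨x, ofComps p x (w x)⟩ : TangentBundle (𝓡 d) M)) y := by
  refine (Trivialization.contMDiffAt_section_iff
    (trivializationAt (Model d) (TangentSpace (𝓡 d)) p) hy).2 (hw.congr_of_eventuallyEq ?_)
  filter_upwards [(chartAt (Model d) p).open_source.mem_nhds hy] with x hx
  exact comps_ofComps hx (w x)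

/-- A partition of unity glues the local section `W` near `p` with the zero section elsewhere. -/
theorem exists_isSectionOf_eq [T2Space M] [SecondCountableTopology M] (D : Distribution d M)
    (p : M) (W : VField d M) {U : Set M} (hU : U ∈ 𝓝 p)
    (hW : ∀ y ∈ U, ContMDiffAt (𝓡 d) (𝓡 d).tangent ∞
      (fun x => (⟨x, W x⟩ : TangentBundle (𝓡 d) M)) y)
    (hD : ∀ y ∈ U, W y ∈ D y) : ∃ V : VField d M, IsSectionOf D V ∧ V p = W p := by
  have : LocallyCompactSpace M := Manifold.locallyCompact_of_finiteDimensional (𝓡 d)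
  obtain ⟨s, hs⟩ := exists_contMDiffSection_forall_mem_convex_of_local (I := 𝓡 d) (n := ⊤)
    (F_fiber := Model d) (V := fun x : M => TangentSpace (𝓡 d) x)
    -- These fibrewise constraints are convex, and the value is prescribed only at `p`; away from
    -- `p` the zero section satisfies them.
    (fun x => {v | v ∈ D x ∧ (x = p → v = W x)})
    (fun x a ha b hb s t _ _ hst =>
      ⟨(D x).add_mem ((D x).smul_mem _ ha.1) ((D x).smul_mem _ hb.1), fun h => by
        rw [ha.2 h, hb.2 h, ← add_smul, hst, one_smul]⟩)
    (fun x₀ => by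
      by_cases h : x₀ = p
      · exact ⟨U, h ▸ hU, W, fun y hy => (hW y hy).contMDiffWithinAt,
          fun y hy => ⟨hD y hy, fun _ => rfl⟩⟩
      · exact ⟨{p}ᶜ, isOpen_compl_singleton.mem_nhds h, fun _ => 0,
          (contMDiff_zeroSection ℝ _).contMDiffOn,
          fun y hy => ⟨(D y).zero_mem, fun h' => (hy h').elim⟩⟩)
  exact ⟨fun x => s x, ⟨s.contMDiff, fun x => (hs x).1⟩, (hs p).2 rfl⟩

theorem exists_isSmoothField_eq [T2Space M] [SecondCountableTopology M] (p : M)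
    (v : TangentSpace (𝓡 d) p) : ∃ V : VField d M, IsSmoothField V ∧ V p = v := by
  obtain ⟨V, hV, hp⟩ := exists_isSectionOf_eq (fun _ => ⊤) p (fun x => ofComps p x v)
    ((chartAt (Model d) p).open_source.mem_nhds (mem_chart_source _ p))
    (fun y hy => contMDiffAt_ofComps hy contMDiffAt_const) (fun _ _ => trivial)
  exact ⟨V, hV.1, hp.trans (ofComps_self p v)⟩

variable {n : ℕ} {N : Type v} [TopologicalSpace N] [ChartedSpace (Model n) N]
  [IsManifold (𝓡 n) ∞ N]

/-- The kernel of a surjective Jacobian varies smoothly, so a kernel vector at `p` can be corrected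
by a smooth projection to stay in the kernel nearby. -/
theorem exists_isSectionOf_vert_eq [T2Space M] [SecondCountableTopology M] {F : M → N}
    (hF : ContMDiff (𝓡 d) (𝓡 n) ∞ F) {p : M}
    (hp : Function.Surjective (mfderiv (𝓡 d) (𝓡 n) F p)) (v : TangentSpace (𝓡 d) p)
    (hv : v ∈ vert d n F p) : ∃ V : VField d M, IsSectionOf (vert d n F) V ∧ V p = v := by
  have hsurj : Function.Surjective (localDeriv d n F p p) := fun z => by
    obtain ⟨u, hu⟩ := hp z
    exact ⟨u, (localDeriv_self hF p u).trans hu⟩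
  obtain ⟨R₀, hR₀⟩ := (localDeriv d n F p p).toLinearMap.exists_rightInverse_of_surjective
    (LinearMap.range_eq_top.2 hsurj)
  let R : Model n →L[ℝ] Model d := LinearMap.toContinuousLinearMap R₀
  have hR : localDeriv d n F p p ∘L R = ContinuousLinearMap.id ℝ (Model n) := by
    ext1 z
    exact congrArg (fun T => T z) hR₀
  let D := localDeriv d n F p
  let a : Model d := v
  -- `R (D R)⁻¹` is a right inverse of `D y` wherever `D y ∘L R` is invertible, so subtracting its
  -- value on `D y a` projects `a` into the kernel; at `p` nothing is subtracted.
  let w : M → Model d := fun y => a - R ((D y ∘L R).inverse (D y a))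
  have hDR : ∀ y ∈ chartDomain d n F p,
      ContMDiffAt (𝓡 d) 𝓘(ℝ, Model n →L[ℝ] Model n) ∞ (fun y => D y ∘L R) y := fun y hy =>
    (contMDiffAt_localDeriv hF hy).clm_comp contMDiffAt_const
  have hinv : ∀ᶠ y in 𝓝 p, (D y ∘L R).IsInvertible := by
    have h := (hDR p (mem_chartDomain F p)).continuousAt
    have h1 : Set.range ((↑) : (Model n ≃L[ℝ] Model n) → Model n →L[ℝ] Model n) ∈
        𝓝 (D p ∘L R) := by
      rw [show D p ∘L R = _ from hR]
      exact (ContinuousLinearEquiv.refl ℝ (Model n)).nhds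
    exact h.preimage_mem_nhds h1
  obtain ⟨V, hV, hVp⟩ := exists_isSectionOf_eq (vert d n F) p (fun y => ofComps p y (w y))
    (U := chartDomain d n F p ∩ {y | (D y ∘L R).IsInvertible})
    (Filter.inter_mem ((isOpen_chartDomain hF.continuous p).mem_nhds (mem_chartDomain F p)) hinv)
    (fun y hy => by
      refine contMDiffAt_ofComps hy.1.1 ?_
      obtain ⟨e, he⟩ := hy.2
      have h1 : ContMDiffAt (𝓡 d) 𝓘(ℝ, Model n →L[ℝ] Model n) ∞
          (fun y => (D y ∘L R).inverse) y := by
        refine ContDiffAt.comp_contMDiffAt (g := ContinuousLinearMap.inverse) ?_ (hDR y hy.1)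
        rw [← he]
        exact contDiffAt_map_inverse e
      have h2 : ContMDiffAt (𝓡 d) 𝓘(ℝ, Model n) ∞ (fun y => D y a) y :=
        (contMDiffAt_localDeriv hF hy.1).clm_apply contMDiffAt_const
      have h3 : ContMDiffAt (𝓡 d) 𝓘(ℝ, Model d) ∞
          (fun y => R ((D y ∘L R).inverse (D y a))) y :=
        contMDiffAt_const.clm_apply (h1.clm_apply h2)
      exact contMDiffAt_const.sub h3)
    (fun y hy => by
      refine LinearMap.mem_ker.2 ?_
      obtain ⟨e, he⟩ := hy.2
      have h1 : D y (w y) = 0 := by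
        have h2 : D y (R ((D y ∘L R).inverse (D y a))) = D y a := by
          change (D y ∘L R) _ = _
          rw [← he, ContinuousLinearMap.inverse_equiv]
          exact e.apply_symm_apply _
        simp only [w, map_sub, h2, sub_self]
      have h3 := comps_mfderiv hF hy.1 (ofComps p y (w y))
      rw [comps_ofComps hy.1.1] at h3
      have h4 := ofComps_comps hy.1.2 (mfderiv (𝓡 d) (𝓡 n) F y (ofComps p y (w y)))
      refine h4.symm.trans ?_
      exact (congrArg _ (h3.trans h1)).trans (map_zero _))
  refine ⟨V, hV, hVp.trans ((ofComps_self p _).trans ?_)⟩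
  have h0 : D p a = 0 := (localDeriv_self hF p v).trans hv
  change a - R ((D p ∘L R).inverse (D p a)) = a
  rw [h0, map_zero, map_zero, sub_zero]

/-- The pointwise preimage under an immersion is unique; its smoothness follows from a smooth local
left inverse of the Jacobian, `(P D)⁻¹ P`, where `P` is a left inverse at the base point. -/
theorem exists_push_eq {F : M → N} (hF : ContMDiff (𝓡 d) (𝓡 n) ∞ F)
    (hinj : ∀ p, Function.Injective (mfderiv (𝓡 d) (𝓡 n) F p))
    {Z : ∀ p : M, TangentSpace (𝓡 n) (F p)} (hZ : IsSmoothAlong (d := n) d F Z)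
    (hr : ∀ p, ∃ u, mfderiv (𝓡 d) (𝓡 n) F p u = Z p) :
    ∃ Y : VField d M, IsSmoothField Y ∧ push F Y = Z := by
  choose Y hY using hr
  refine ⟨Y, fun p => ?_, funext hY⟩
  have hinj' : Function.Injective (localDeriv d n F p p) := fun a b hab =>
    hinj p ((localDeriv_self hF p a).symm.trans (hab.trans (localDeriv_self hF p b)))
  obtain ⟨P₀, hP₀⟩ := (localDeriv d n F p p).toLinearMap.exists_leftInverse_of_injective
    (LinearMap.ker_eq_bot.2 hinj')
  let P : Model n →L[ℝ] Model d := LinearMap.toContinuousLinearMap P₀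
  have hP : P ∘L localDeriv d n F p p = ContinuousLinearMap.id ℝ (Model d) := by
    ext1 z
    exact congrArg (fun T => T z) hP₀
  let D := localDeriv d n F p
  have hPD : ContMDiffAt (𝓡 d) 𝓘(ℝ, Model d →L[ℝ] Model d) ∞ (fun y => P ∘L D y) p :=
    contMDiffAt_const.clm_comp (contMDiffAt_localDeriv hF (mem_chartDomain F p))
  have hinv : ∀ᶠ y in 𝓝 p, (P ∘L D y).IsInvertible := by
    have h1 : Set.range ((↑) : (Model d ≃L[ℝ] Model d) → Model d →L[ℝ] Model d) ∈
        𝓝 (P ∘L D p) := by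
      rw [show P ∘L D p = _ from hP]
      exact (ContinuousLinearEquiv.refl ℝ (Model d)).nhds
    exact hPD.continuousAt.preimage_mem_nhds h1
  have h1 : ContMDiffAt (𝓡 d) 𝓘(ℝ, Model d →L[ℝ] Model d) ∞
      (fun y => (P ∘L D y).inverse) p := by
    refine ContDiffAt.comp_contMDiffAt (g := ContinuousLinearMap.inverse) ?_ hPD
    rw [show P ∘L D p = _ from hP]
    exact contDiffAt_map_inverse (ContinuousLinearEquiv.refl ℝ (Model d))
  have h2 : ContMDiffAt (𝓡 d) 𝓘(ℝ, Model d) ∞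
      (fun y => (P ∘L D y).inverse (P (comps (F p) (F y) (Z y)))) p :=
    h1.clm_apply (contMDiffAt_const.clm_apply (hZ.comps p))
  refine (contMDiffAt_ofComps (mem_chart_source _ p) h2).congr_of_eventuallyEq ?_
  filter_upwards [(isOpen_chartDomain (d := d) (n := n) hF.continuous p).mem_nhds
    (mem_chartDomain F p), hinv] with y hy hi
  obtain ⟨e, he⟩ := hi
  have h3 : P (comps (F p) (F y) (Z y)) = (P ∘L D y) (comps p y (Y y)) := by
    rw [← hY y, comps_mfderiv hF hy]
    rfl
  have h4 : Y y = ofComps p y ((P ∘L D y).inverse (P (comps (F p) (F y) (Z y)))) := by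
    rw [h3, ← he, ContinuousLinearMap.inverse_equiv]
    exact ((congrArg _ (e.symm_apply_apply _)).trans (ofComps_comps hy.1 (Y y))).symm
  rw [← h4]

end Extension


/-! ### Algebra of `(φ, ξ, η)` and the derivative of `ξ`. -/

section Structure

variable {d : ℕ} {M : Type u} [TopologicalSpace M] [ChartedSpace (Model d) M]
  [IsManifold (𝓡 d) ∞ M] {ε : ℝ} {g : Metric d M} {φ : EndField d M} {ξ : VField d M}
  {η : ∀ x : M, TangentSpace (𝓡 d) x →L[ℝ] ℝ}

namespace IsLorentzianAlmostContact

theorem eps_mul_self (h : IsLorentzianAlmostContact ε g φ ξ η) : ε * ε = 1 := by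
  rcases h.eps with h | h <;> rw [h] <;> norm_num

theorem phi_xi (h : IsLorentzianAlmostContact ε g φ ξ η) (x : M) : φ x (ξ x) = 0 := by
  have h1 : φ x (φ x (ξ x)) = 0 := by rw [h.phi_sq, h.eta_xi, ← add_smul, add_neg_cancel, zero_smul]
  -- `φξ` is orthogonal to the image of `φ`. This does not yet give `φξ = 0`: `η(φξ) = 0` is
  -- extracted below from `metric_phi` at `φξ`, and then `0 = φ²(φξ) = ε φξ`.
  have h2 : ∀ w, g.form x (φ x (ξ x)) (φ x w) = 0 := fun w => by
    rw [h.metric_phi, h.eta_xi, h.eta_eq x w, g.symm x w]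
    linear_combination -(g.form x (ξ x) w) * h.eps_mul_self
  have h3 := h.phi_sq x (φ x (ξ x))
  rw [h1, map_zero] at h3
  have h4 : η x (φ x (ξ x)) * η x (φ x (ξ x)) = 0 := by
    have := h.metric_phi x (φ x (ξ x)) (φ x (ξ x))
    rwa [h2, h1, map_zero, zero_add, eq_comm] at this
  rw [mul_self_eq_zero.1 h4, zero_smul, add_zero] at h3
  have h5 := congrArg (ε • ·) h3
  simpa [smul_smul, h.eps_mul_self] using h5.symm

/-- Computing `φ³v` as `φ²(φv)` and as `φ(φ²v)` leaves `η(φv) ξ = 0`. -/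
theorem eta_phi (h : IsLorentzianAlmostContact ε g φ ξ η) (x : M) (v : TangentSpace (𝓡 d) x) :
    η x (φ x v) = 0 := by
  have h1 := h.phi_sq x (φ x v)
  rw [h.phi_sq x v, map_add, map_smul, map_smul, h.phi_xi, smul_zero, add_zero, left_eq_add] at h1
  have h2 := congrArg (η x) h1
  rw [map_smul, h.eta_xi, map_zero, smul_eq_mul] at h2
  have h3 := h.eps_mul_self
  linear_combination (-ε) * h2 - η x (φ x v) * h3

/-- Put `φw` for `w` in `metric_phi` and expand `φ²w`; the `η` terms vanish because `η ∘ φ = 0`. -/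
theorem form_phi_left (h : IsLorentzianAlmostContact ε g φ ξ η) (x : M)
    (v w : TangentSpace (𝓡 d) x) : g.form x (φ x v) w = ε * g.form x v (φ x w) := by
  have h1 := h.metric_phi x v (φ x w)
  rw [h.eta_phi, mul_zero, add_zero, h.phi_sq, map_add, map_smul, map_smul, smul_eq_mul,
    smul_eq_mul] at h1
  have h2 := h.eta_eq x (φ x v)
  rw [h.eta_phi] at h2
  have h3 := h.eps_mul_self
  linear_combination ε * h1 - (g.form x (φ x v) w) * h3 + η x w * h2

theorem phi_phi_phi (h : IsLorentzianAlmostContact ε g φ ξ η) (x : M)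
    (v : TangentSpace (𝓡 d) x) : φ x (φ x (φ x v)) = ε • φ x v := by
  rw [h.phi_sq, h.eta_phi, zero_smul, add_zero]

theorem isSmoothField_app (h : IsLorentzianAlmostContact ε g φ ξ η) {X : VField d M}
    (hX : IsSmoothField X) : IsSmoothField (φ.app X) :=
  h.smooth_phi.clm_bundle_apply hX

theorem app_xi (h : IsLorentzianAlmostContact ε g φ ξ η) : φ.app ξ = fun _ => 0 :=
  funext h.phi_xi

end IsLorentzianAlmostContact

theorem nabla_zero (g : Metric d M) (X : VField d M) : nabla g X (fun _ => 0) = fun _ => 0 :=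
  funext fun p => covAlong_zero g continuous_id p (X p)

theorem mvfderiv_form_nabla (g : Metric d M) (X : VField d M) {Y Z : VField d M}
    (hY : IsSmoothField Y) (hZ : IsSmoothField Z) (p : M) :
    mvfderiv (𝓡 d) (fun y => g.form y (Y y) (Z y)) p (X p) =
      g.form p (nabla g X Y p) (Z p) + g.form p (Y p) (nabla g X Z p) :=
  mvfderiv_form g (fun x : M => x) (isSmoothAlong_id hY) (isSmoothAlong_id hZ) p (X p)

theorem nabla_form_eq_neg (g : Metric d M) (X : VField d M) {Y Z : VField d M}
    (hY : IsSmoothField Y) (hZ : IsSmoothField Z) (h : ∀ x, g.form x (Y x) (Z x) = 0) (p : M) :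
    g.form p (nabla g X Y p) (Z p) = - g.form p (Y p) (nabla g X Z p) := by
  have h1 := mvfderiv_form_nabla g X hY hZ p
  rw [funext h] at h1
  have h2 : mvfderiv (𝓡 d) (fun _ : M => (0 : ℝ)) p (X p) = 0 :=
    congrArg (fun T => T (X p)) (mvfderiv_const (I := 𝓡 d) (0 : ℝ) (x := p))
  rw [h2] at h1
  linarith

/-- `∇_Z ξ` agrees with `ε φ Z` up to a multiple of `ξ`. -/
theorem IsLorentzianSasakian.exists_nabla_xi (h : IsLorentzianSasakian ε g φ ξ η) {Z : VField d M}
    (hZ : IsSmoothField Z) (x : M) : ∃ c : ℝ, nabla g Z ξ x = ε • φ x (Z x) + c • ξ x := by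
  have h0 := h.toIsLorentzianAlmostContact
  -- Since `φξ = 0`, the structure equation at `ξ` reduces to `φ(∇_Z ξ) = ε φ²Z`; applying `φ` once
  -- more recovers `∇_Z ξ` up to its `ξ` component, which is the constant `c`.
  have h1 := h.nabla_phi Z ξ hZ h.smooth_xi x
  rw [h0.app_xi, nabla_zero, h0.phi_xi, map_zero, mul_zero, zero_smul, zero_add, h.eta_xi,
    zero_sub, neg_smul, neg_inj] at h1
  have h2 := congrArg (φ x) h1
  rw [map_smul, h0.phi_phi_phi, h.phi_sq, smul_smul, h0.eps_mul_self, one_smul] at h2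
  refine ⟨-ε * η x (nabla g Z ξ x), ?_⟩
  rw [← h2, smul_add, smul_smul, h0.eps_mul_self, one_smul, smul_smul, add_assoc, ← add_smul]
  ring_nf
  simp

end Structure

/-! ### Skewness coming from the submersion condition. -/

section Submersion

variable {d n : ℕ} {M : Type u} [TopologicalSpace M] [ChartedSpace (Model d) M]
  [IsManifold (𝓡 d) ∞ M]
  {N : Type v} [TopologicalSpace N] [ChartedSpace (Model n) N] [IsManifold (𝓡 n) ∞ N]
  {gM : Metric d M} {gN : Metric n N} {F : M → N}

/-- One horizontal argument suffices: the vertical part of the other is killed by `F_*` and is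
orthogonal to it. -/
theorem IsSemiRiemannianSubmersion.form_mfderiv (hF : IsSemiRiemannianSubmersion gM gN F) (x : M)
    (v w : TangentSpace (𝓡 d) x) (hw : w ∈ horiz n gM F x) :
    gN.form (F x) (mfderiv (𝓡 d) (𝓡 n) F x v) (mfderiv (𝓡 d) (𝓡 n) F x w) = gM.form x v w := by
  obtain ⟨a, ha, b, hb, rfl⟩ := Submodule.mem_sup.1
    ((hF.isCompl x).sup_eq_top ▸ Submodule.mem_top : v ∈ vert d n F x ⊔ horiz n gM F x)
  have ha' : mfderiv (𝓡 d) (𝓡 n) F x a = 0 := ha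
  rw [map_add, ha', zero_add, hF.isometry x b hb w hw, map_add, add_apply,
    gM.symm x a, hw a ha, zero_add]

/-- For a vertical field `W`, the field of bilinear forms `(X, Y) ↦ g(∇_X W, Y)` is skew on the
horizontal distribution. -/
theorem IsSemiRiemannianSubmersion.nabla_vert_skew (hF : IsSemiRiemannianSubmersion gM gN F)
    {X Y W : VField d M} (hX : IsSectionOf (horiz n gM F) X) (hY : IsSectionOf (horiz n gM F) Y)
    (hW : IsSectionOf (vert d n F) W) (p : M) :
    gM.form p (nabla gM X W p) (Y p) + gM.form p (X p) (nabla gM Y W p) = 0 := by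
  have hpush : push F W = fun _ => 0 := funext hW.2
  -- As `F_* W = 0`, symmetry of `∇F_*` gives `∇^F_W (F_* Z) = F_*(∇_W Z - ∇_Z W)`. Differentiating
  -- `g_N(F_* X, F_* Y) = g_M(X, Y)` along `W` on both sides and comparing leaves the skewness.
  have hff : ∀ {Z : VField d M}, IsSmoothField Z → secondFF gM gN F W Z p =
      - mfderiv (𝓡 d) (𝓡 n) F p (nabla gM Z W p) := by
    intro Z hZ
    rw [secondFF_symm gM gN hF.smooth hW.1 hZ, secondFF, hpush,
      covAlong_zero gN hF.smooth.continuous, zero_sub]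
  have hcov : ∀ {Z : VField d M}, IsSmoothField Z → covAlong gN F (push F Z) p (W p) =
      mfderiv (𝓡 d) (𝓡 n) F p (nabla gM W Z p) - mfderiv (𝓡 d) (𝓡 n) F p (nabla gM Z W p) := by
    intro Z hZ
    have h := hff hZ
    rw [secondFF] at h
    rw [eq_add_of_sub_eq h]
    abel
  have h1 := mvfderiv_form gN F (isSmoothAlong_push hF.smooth hX.1)
    (isSmoothAlong_push hF.smooth hY.1) p (W p)
  have h2 := mvfderiv_form_nabla gM W hX.1 hY.1 p
  rw [hcov hX.1, hcov hY.1, map_sub, map_sub, sub_apply, gN.symm (F p) (push F X p),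
    gN.symm (F p) (push F X p)] at h1
  simp only [push, hF.form_mfderiv _ _ _ (hX.2 _), hF.form_mfderiv _ _ _ (hY.2 _)] at h1
  rw [h2, gM.symm p (X p)] at h1
  rw [gM.symm p (X p)]
  linarith

theorem IsSemiRiemannianSubmersion.oneillA_zero (hF : IsSemiRiemannianSubmersion gM gN F)
    (X : VField d M) : oneillA hF X (fun _ => 0) = fun _ => 0 := by
  have h1 : horPart hF (fun _ => 0) = fun _ => 0 := funext fun x => map_zero _
  have h2 : verPart hF (fun _ => 0) = fun _ => 0 := funext fun x => map_zero _
  funext x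
  simp only [oneillA, h1, h2, nabla_zero, add_zero]

end Submersion

/-! ### Anti-invariant submersions with horizontal `ξ`: the vertical space and condition (i). -/

section AntiInvariant

variable {d n : ℕ} {M : Type u} [TopologicalSpace M] [ChartedSpace (Model d) M]
  [IsManifold (𝓡 d) ∞ M]
  {N : Type v} [TopologicalSpace N] [ChartedSpace (Model n) N]
  {ε : ℝ} {gM : Metric d M} {φ : EndField d M} {ξ : VField d M}
  {η : ∀ x : M, TangentSpace (𝓡 d) x →L[ℝ] ℝ} {F : M → N}

theorem IsLorentzianAlmostContact.eta_vert (hM : IsLorentzianAlmostContact ε gM φ ξ η)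
    (hξ : ∀ x, ξ x ∈ horiz n gM F x) {x : M} {v : TangentSpace (𝓡 d) x}
    (hv : v ∈ vert d n F x) : η x v = 0 := by
  rw [hM.eta_eq, gM.symm, hξ x v hv, mul_zero]

theorem IsLorentzianAlmostContact.form_phi_phi_vert (hM : IsLorentzianAlmostContact ε gM φ ξ η)
    (hξ : ∀ x, ξ x ∈ horiz n gM F x) {x : M} {v : TangentSpace (𝓡 d) x}
    (hv : v ∈ vert d n F x) (w : TangentSpace (𝓡 d) x) :
    gM.form x (φ x w) (φ x v) = gM.form x w v := by
  rw [hM.metric_phi, hM.eta_vert hξ hv, mul_zero, add_zero]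

theorem IsLorentzianAlmostContact.isSectionOf_app (hM : IsLorentzianAlmostContact ε gM φ ξ η)
    (hanti : IsAntiInvariant gM φ n F) {W : VField d M} (hW : IsSectionOf (vert d n F) W) :
    IsSectionOf (horiz n gM F) (φ.app W) :=
  ⟨hM.isSmoothField_app hW.1, fun x => hanti x _ (hW.2 x)⟩

/-- For vertical `W` and `V`, `g(∇_ξ W, φ V) = -ε g(∇_ξ V, φ W)`. -/
theorem IsLorentzianSasakian.form_nabla_xi_vert_comm (hM : IsLorentzianSasakian ε gM φ ξ η)
    (hanti : IsAntiInvariant gM φ n F) {W V : VField d M}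
    (hW : IsSectionOf (vert d n F) W) (hV : IsSectionOf (vert d n F) V) (x : M) :
    gM.form x (nabla gM ξ W x) (φ x (V x)) = -ε * gM.form x (nabla gM ξ V x) (φ x (W x)) := by
  have h0 := hM.toIsLorentzianAlmostContact
  have hφV := h0.isSectionOf_app hanti hV
  have h1 := nabla_form_eq_neg gM ξ hW.1 hφV.1
    (fun y => (gM.symm y _ _).trans (hφV.2 y _ (hW.2 y))) x
  -- `φξ = 0` makes `(∇_ξ φ)V` vanish, so `∇_ξ` commutes with `φ` here.
  have h2 := hM.nabla_phi ξ V hM.smooth_xi hV.1 x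
  rw [h0.phi_xi, map_zero, zero_apply, mul_zero, zero_smul, map_zero, smul_zero, add_zero,
    sub_eq_zero] at h2
  rw [h2, gM.symm x (W x), h0.form_phi_left] at h1
  change gM.form x _ (φ x (V x)) = _ at h1
  rw [h1]
  ring

/-- The horizontal distribution is then all of `TM`: `M` itself is an integral manifold through
every point, and an integral manifold has no normal directions. -/
theorem isTotallyGeodesicFoliation_of_vert_eq_zero [T2Space M] [SecondCountableTopology M]
    (hv : ∀ x, ∀ v ∈ vert d n F x, v = 0) :
    DefinesTotallyGeodesicFoliation gM (horiz n gM F) := by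
  have htop : ∀ x (w : TangentSpace (𝓡 d) x), w ∈ horiz n gM F x := fun x w u hu => by
    rw [hv x u hu, map_zero]
  have hid : ∀ (q : M) (w : TangentSpace (𝓡 d) q),
      mfderiv (𝓡 d) (𝓡 d) (fun x : M => x) q w = w := fun q w =>
    congrArg (fun T => T w) (mfderiv_id (I := 𝓡 d) (x := q))
  refine ⟨fun p => ⟨d, M, inferInstance, inferInstance, fun x => x, inferInstance, inferInstance,
    inferInstance, ⟨contMDiff_id, fun _ _ h => h, fun q a b hab => ?_, fun q w =>
      ⟨fun _ => ⟨w, hid q w⟩, fun _ => htop q w⟩⟩, p, rfl⟩, ?_⟩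
  · rwa [hid, hid] at hab
  · intro k L _ _ _ _ _ f hf X Y _ _ q
    exact (hf.tangent q _).1 (htop _ _)

/-- `ξ` is tangent to the leaves, so its derivative along a leaf is tangent too; that derivative is
`ε φw` plus a multiple of `ξ`. -/
theorem IsLorentzianSasakian.phi_mem_horiz (hM : IsLorentzianSasakian ε gM φ ξ η)
    (hξ : ∀ x, ξ x ∈ horiz n gM F x) [T2Space M] [SecondCountableTopology M]
    (h : DefinesTotallyGeodesicFoliation gM (horiz n gM F)) {p : M} {w : TangentSpace (𝓡 d) p}
    (hw : w ∈ horiz n gM F p) : φ p w ∈ horiz n gM F p := by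
  obtain ⟨k, L, _, _, f, _, _, _, hf, q, rfl⟩ := h.1 p
  obtain ⟨Y, hY, hYξ⟩ := exists_push_eq hf.smooth hf.immersion (Z := fun q => ξ (f q))
    (hM.smooth_xi.comp hf.smooth) (fun q => (hf.tangent q _).1 (hξ (f q)))
  obtain ⟨u, hu⟩ := (hf.tangent q w).1 hw
  obtain ⟨X, hX, hXu⟩ := exists_isSmoothField_eq q u
  obtain ⟨Z, hZ, hZw⟩ := exists_isSmoothField_eq (f q) w
  have h1 := (hf.tangent q _).2 (h.2 k L f hf X Y hX hY q)
  -- By the chain rule, differentiating the restriction of `ξ` to the leaf agrees with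
  -- differentiating `ξ` on `M`.
  have h2 : covAlong gM f (push f Y) q (X q) = nabla gM Z ξ (f q) := by
    rw [hYξ, hXu, covAlong_eq, hu, nabla_eq, hZw]
    have hd := ((isSmoothAlong_id hM.smooth_xi).comps (f q)).mdifferentiableAt (by simp)
    have h3 : compsDeriv f (fun q => ξ (f q)) q u =
        compsDeriv (fun x : M => x) ξ (f q) (mfderiv (𝓡 k) (𝓡 d) f q u) :=
      mfderiv_comp_apply q hd (hf.smooth.mdifferentiable (by simp) q) u
    rw [h3, hu]
  obtain ⟨c, hc⟩ := hM.exists_nabla_xi hZ (f q)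
  rw [h2, hc, hZw] at h1
  have h4 := (horiz n gM F (f q)).smul_mem ε
    ((Submodule.add_mem_iff_left _ (Submodule.smul_mem _ c (hξ (f q)))).1 h1)
  rwa [smul_smul, hM.eps_mul_self, one_smul] at h4

variable [IsManifold (𝓡 n) ∞ N] {gN : Metric n N}

/-- For vertical `W` and `V`, `g(∇_ξ W, φ V) = g(W, V)`. -/
theorem IsLorentzianSasakian.form_nabla_xi_vert (hM : IsLorentzianSasakian ε gM φ ξ η)
    (hF : IsSemiRiemannianSubmersion gM gN F) (hanti : IsAntiInvariant gM φ n F)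
    (hξ : ∀ x, ξ x ∈ horiz n gM F x) {W V : VField d M} (hW : IsSectionOf (vert d n F) W)
    (hV : IsSectionOf (vert d n F) V) (x : M) :
    gM.form x (nabla gM ξ W x) (φ x (V x)) = gM.form x (W x) (V x) := by
  have h0 := hM.toIsLorentzianAlmostContact
  have hφV := h0.isSectionOf_app hanti hV
  -- Skewness trades `g(∇_ξ W, φV)` for `-g(∇_{φV} W, ξ)`; as `g(W, ξ) = 0` this is `g(W, ∇_{φV}
  -- ξ)`, and `∇_{φV} ξ` is `ε φ²V = V` modulo `ξ`.
  have h1 := hF.nabla_vert_skew ⟨hM.smooth_xi, hξ⟩ hφV hW x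
  have h2 := nabla_form_eq_neg gM (φ.app V) hW.1 hM.smooth_xi
    (fun y => (gM.symm y _ _).trans (hξ y _ (hW.2 y))) x
  obtain ⟨c, hc⟩ := hM.exists_nabla_xi hφV.1 x
  have h3 : gM.form x (W x) (nabla gM (φ.app V) ξ x) = gM.form x (W x) (V x) := by
    rw [hc, EndField.app, hM.phi_sq, h0.eta_vert hξ (hV.2 x), zero_smul, add_zero, smul_smul,
      h0.eps_mul_self, one_smul, map_add, map_smul, gM.symm x (W x) (ξ x), hξ x _ (hW.2 x),
      smul_zero, add_zero]
  rw [gM.symm x (ξ x)] at h1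
  change gM.form x _ (φ x (V x)) + _ = 0 at h1
  linarith

theorem IsLorentzianSasakian.vert_eq_zero_of_foliation (hM : IsLorentzianSasakian ε gM φ ξ η)
    (hF : IsSemiRiemannianSubmersion gM gN F) (hanti : IsAntiInvariant gM φ n F)
    (hξ : ∀ x, ξ x ∈ horiz n gM F x) [T2Space M] [SecondCountableTopology M]
    (h : DefinesTotallyGeodesicFoliation gM (horiz n gM F)) (x : M) (v : TangentSpace (𝓡 d) x)
    (hv : v ∈ vert d n F x) : v = 0 := by
  refine hF.fibres x v hv fun w hw => ?_
  rw [← hM.form_phi_phi_vert hξ hw, hM.form_phi_left]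
  have h1 := hM.phi_mem_horiz hξ h (hanti x w hw) v hv
  rw [gM.symm, h1, mul_zero]

end AntiInvariant

end SemiRiem

/-! ### The equivalence, through vanishing of the vertical space. -/

theorem mainTheorem7 {d n : ℕ}
    {M : Type u} [TopologicalSpace M] [T2Space M] [SecondCountableTopology M]
    [ChartedSpace (SemiRiem.Model d) M] [IsManifold (𝓡 d) ∞ M]
    {N : Type v} [TopologicalSpace N] [T2Space N] [SecondCountableTopology N]
    [ChartedSpace (SemiRiem.Model n) N] [IsManifold (𝓡 n) ∞ N]
    (ε : ℝ) (gM : SemiRiem.Metric d M) (φ : SemiRiem.EndField d M) (ξ : SemiRiem.VField d M)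
    (η : ∀ x : M, TangentSpace (𝓡 d) x →L[ℝ] ℝ)
    (hM : SemiRiem.IsLorentzianSasakian ε gM φ ξ η)
    (gN : SemiRiem.Metric n N) (hN : gN.IsLorentzian)
    (F : M → N) (hF : SemiRiem.IsSemiRiemannianSubmersion gM gN F)
    (hanti : SemiRiem.IsAntiInvariant gM φ n F)
    (hξ : ∀ x : M, ξ x ∈ SemiRiem.horiz n gM F x) :
    List.TFAE [
      SemiRiem.DefinesTotallyGeodesicFoliation gM (SemiRiem.horiz n gM F),
      ∀ X Y V : SemiRiem.VField d M,
        SemiRiem.IsSectionOf (SemiRiem.horiz n gM F) X →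
        SemiRiem.IsSectionOf (SemiRiem.horiz n gM F) Y →
        SemiRiem.IsSectionOf (SemiRiem.vert d n F) V → ∀ x : M,
        gM.form x (SemiRiem.oneillA hF X (SemiRiem.partB hF φ Y) x) (φ x (V x))
          = gM.form x (SemiRiem.partC hF φ Y x) (φ x (SemiRiem.oneillA hF X V x))
            + ε * η x (Y x) * gM.form x (X x) (φ x (V x)),
      ∀ X Y V : SemiRiem.VField d M,
        SemiRiem.IsSectionOf (SemiRiem.horiz n gM F) X →
        SemiRiem.IsSectionOf (SemiRiem.horiz n gM F) Y →
        SemiRiem.IsSectionOf (SemiRiem.vert d n F) V → ∀ x : M,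
        gN.form (F x) (SemiRiem.secondFF gM gN F Y (φ.app X) x)
            (mfderiv (𝓡 d) (𝓡 n) F x (φ x (V x)))
          = gM.form x (SemiRiem.partC hF φ Y x) (φ x (SemiRiem.oneillA hF X V x))
            + ε * η x (Y x) * gM.form x (X x) (φ x (V x))] := by
  have h0 := hM.toIsLorentzianAlmostContact
  have hext := fun (p : M) (v : TangentSpace (𝓡 d) p) (hv : v ∈ SemiRiem.vert d n F p) =>
    SemiRiem.exists_isSectionOf_vert_eq hF.smooth (hF.submersion p) v hv
  have hBξ : SemiRiem.partB hF φ ξ = fun _ => 0 := by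
    rw [SemiRiem.partB, h0.app_xi]
    exact funext fun x => map_zero _
  have hCξ : SemiRiem.partC hF φ ξ = fun _ => 0 := by
    rw [SemiRiem.partC, h0.app_xi]
    exact funext fun x => map_zero _
  have hξξ : ε * -ε = -1 := by linear_combination -h0.eps_mul_self
  have hzero : (∀ x, ∀ v ∈ SemiRiem.vert d n F x, v = 0) → ∀ V : SemiRiem.VField d M,
      SemiRiem.IsSectionOf (SemiRiem.vert d n F) V → V = fun _ => 0 :=
    fun h V hV => funext fun x => h x _ (hV.2 x)
  have e₁ : SemiRiem.DefinesTotallyGeodesicFoliation gM (SemiRiem.horiz n gM F) ↔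
      ∀ x, ∀ v ∈ SemiRiem.vert d n F x, v = 0 :=
    ⟨hM.vert_eq_zero_of_foliation hF hanti hξ, SemiRiem.isTotallyGeodesicFoliation_of_vert_eq_zero⟩
  tfae_have 1 → 2 := by
    intro h X Y V _ _ hV x
    rw [hzero (e₁.1 h) V hV, hF.oneillA_zero]
    simp
  tfae_have 1 → 3 := by
    intro h X Y V _ _ hV x
    rw [hzero (e₁.1 h) V hV, hF.oneillA_zero]
    simp
  tfae_have 2 → 1 := by
    refine fun h => e₁.2 fun x v hv => hF.fibres x v hv fun w hw => ?_
    obtain ⟨V, hV, rfl⟩ := hext x v hv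
    obtain ⟨W, hW, rfl⟩ := hext x w hw
    have h1 := h (φ.app V) ξ W (h0.isSectionOf_app hanti hV) ⟨hM.smooth_xi, hξ⟩ hW x
    rw [hBξ, hCξ, hF.oneillA_zero, map_zero, zero_apply, zero_apply, zero_add, hM.eta_xi, hξξ,
      SemiRiem.EndField.app, h0.form_phi_phi_vert hξ hw] at h1
    linarith
  tfae_have 3 → 1 := by
    refine fun h => e₁.2 fun x v hv => hF.fibres x v hv fun w hw => ?_
    obtain ⟨V, hV, rfl⟩ := hext x v hv
    obtain ⟨W, hW, rfl⟩ := hext x w hw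
    have hφV := h0.isSectionOf_app hanti hV
    have h1 := h (φ.app V) ξ W hφV ⟨hM.smooth_xi, hξ⟩ hW x
    have hφφ : φ.app (φ.app V) = fun y => ε • V y := funext fun y => by
      simp only [SemiRiem.EndField.app]
      rw [hM.phi_sq, h0.eta_vert hξ (hV.2 y), zero_smul, add_zero]
    -- `φ²V = εV` is vertical, so the pullback derivative in `∇F_*` contributes nothing; only
    -- `-F_*(∇_ξ φ²V) = -F_*(φ² ∇_ξ V)` survives.
    have hpush : SemiRiem.push (d := n) F (φ.app (φ.app V)) = fun _ => 0 := by
      rw [hφφ]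
      funext y
      exact (map_smul _ ε (V y)).trans ((congrArg (ε • ·) (hV.2 y)).trans (smul_zero ε))
    have hnab : ∀ Z, SemiRiem.IsSmoothField Z → (∀ y, η y (Z y) = 0) →
        SemiRiem.nabla gM ξ (φ.app Z) x = φ x (SemiRiem.nabla gM ξ Z x) := by
      intro Z hZ hη
      have h2 := hM.nabla_phi ξ Z hM.smooth_xi hZ x
      rw [h0.phi_xi, map_zero, zero_apply, mul_zero, zero_smul, map_zero, smul_zero, add_zero,
        sub_eq_zero] at h2
      exact h2
    rw [SemiRiem.secondFF, hpush, SemiRiem.covAlong_zero gN hF.smooth.continuous, zero_sub,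
      hnab _ hφV.1 fun y => h0.eta_phi y _, hnab _ hV.1 fun y => h0.eta_vert hξ (hV.2 y),
      hM.phi_sq, map_neg, neg_apply, hF.form_mfderiv _ _ _ (hanti x _ hw), map_add, map_smul,
      map_smul, add_apply, smul_apply, smul_apply, hCξ, map_zero, zero_apply, zero_add,
      hM.eta_xi, hξξ, SemiRiem.EndField.app, h0.form_phi_phi_vert hξ hw,
      hM.form_nabla_xi_vert hF hanti hξ hV hW] at h1
    have h2 : gM.form x (ξ x) (φ x (W x)) = 0 := by
      rw [gM.symm, h0.form_phi_left, h0.phi_xi, map_zero, mul_zero]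
    -- Condition (iii) has given `ε g(V, W) = g(V, W)`, which is empty for `ε = 1`; this relation,
    -- `g(V, W) = -ε g(V, W)`, is empty for `ε = -1`. Their sum avoids splitting into cases.
    have h3 := hM.form_nabla_xi_vert_comm hanti hV hW x
    rw [hM.form_nabla_xi_vert hF hanti hξ hV hW, hM.form_nabla_xi_vert hF hanti hξ hW hV,
      gM.symm x (W x)] at h3
    rw [h2, smul_eq_mul, smul_eq_mul, mul_zero, add_zero] at h1
    linarith
  tfae_finish
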